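/- For finite graphs $H$ and $G$ let $p(H,G)$ be the probability that $|V(H)|$ vertices of $G$, chosen uniformly at random without repetition, induce a subgraph isomorphic to $H$ (and $p(H,G)=0$ if $|V(G)|<|V(H)|$). For graphs $H_1,H_2,G$ with $|V(H_1)|+|V(H_2)|\le|V(G)|$ let $p(H_1,H_2;G)$ be the probability that a uniformly random pair of disjoint vertex sets of $G$ of sizes $|V(H_1)|,|V(H_2)|$ induces copies of $H_1$ and $H_2$, in this order. Let $\mathcal M_n$ be the set of triangle-free graphs on $n$ vertices up to isomorphism and $\mathcal M=\bigcup_{n\ge 0}\mathcal M_n$. The flag algebra $\mathcal A^0$ of the theory of triangle-free graphs is the quotient of the real vector space $\mathbb R\mathcal M$ by the span of all elements $F-\sum_{G\in\mathcal M_\ell}p(F,G)\,G$ with $F\in\mathcal M_k$, $k\le\ell$; it is a commutative $\mathbb R$-algebra with the product induced by $F_1\cdot F_2=\sum_{G\in\mathcal M_{k_1+k_2}}p(F_1,F_2;G)\,G$ for $F_i\in\mathcal M_{k_i}$, and its unit is the graph with no vertices. Let $\mathrm{Hom}^+(\mathcal A^0,\mathbb R)$ be the set of unital $\mathbb R$-algebra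 homomorphisms $\varphi:\mathcal A^0\to\mathbb R$ with $\varphi(F)\ge 0$ for every $F\in\mathcal M$; for $f,g\in\mathcal A^0$, $f\le g$ means that $\varphi(f)\le\varphi(g)$ for all $\varphi\in\mathrm{Hom}^+(\mathcal A^0,\mathbb R)$. Let $C_5\in\mathcal M_5$ be the pentagon. **Theorem.** In $\mathcal A^0$ we have $$C_5\le\frac{5!}{5^5}.$$ Moreover, asymptotically every triangle-free graph has pentagon density at most $5!/5^5$: for every $\varepsilon>0$ there is an $N$ such that every finite triangle-free graph $G$ with at least $N$ vertices satisfies $p(C_5,G)\le\frac{5!}{5^5}+\varepsilon$. -/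

import Mathlib

namespace TFFlag

noncomputable section

/-! ### Induced densities in finite graphs -/

/-- The vertex set `S` spans in `G` an induced copy of `H`. -/
def IsCopy {W V : Type*} (H : SimpleGraph W) (G : SimpleGraph V) (S : Finset V) : Prop :=
  Nonempty (H ≃g G.induce (S : Set V))

open Classical in
/-- The number of vertex sets of `G` that span an induced copy of `H`. -/
def copyCount {W V : Type*} [Fintype V] (H : SimpleGraph W) (G : SimpleGraph V) : ℕ :=
  (Finset.univ.filter fun S : Finset V => IsCopy H G S).card

open Classical in
/-- The number of pairs of disjoint vertex sets of `G` of which the first spans an induced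
copy of `H₁` and the second an induced copy of `H₂`. -/
def pairCount {W₁ W₂ V : Type*} [Fintype V] (H₁ : SimpleGraph W₁) (H₂ : SimpleGraph W₂)
    (G : SimpleGraph V) : ℕ :=
  (Finset.univ.filter fun P : Finset V × Finset V =>
    Disjoint P.1 P.2 ∧ IsCopy H₁ G P.1 ∧ IsCopy H₂ G P.2).card

/-- `p(H, G)`: the probability that `|V(H)|` vertices of `G`, chosen uniformly at random without
repetition, induce a subgraph isomorphic to `H`. -/
def density {W V : Type*} [Fintype W] [Fintype V] (H : SimpleGraph W) (G : SimpleGraph V) : ℝ :=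
  (copyCount H G : ℝ) / ((Fintype.card V).choose (Fintype.card W) : ℝ)

/-- `p(H₁, H₂; G)`: the probability that a uniformly random pair of disjoint vertex sets of `G` of
sizes `|V(H₁)|` and `|V(H₂)|` induces copies of `H₁` and of `H₂`, in this order. The denominator is
the number of such pairs. -/
def jointDensity {W₁ W₂ V : Type*} [Fintype W₁] [Fintype W₂] [Fintype V]
    (H₁ : SimpleGraph W₁) (H₂ : SimpleGraph W₂) (G : SimpleGraph V) : ℝ :=
  (pairCount H₁ H₂ G : ℝ) /
    (((Fintype.card V).choose (Fintype.card W₁) *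
      (Fintype.card V - Fintype.card W₁).choose (Fintype.card W₂) : ℕ) : ℝ)

/-! ### Models of the theory of triangle-free graphs -/

/-- Isomorphism of triangle-free graphs on `n` labelled vertices. -/
def isoSetoid (n : ℕ) : Setoid {G : SimpleGraph (Fin n) // G.CliqueFree 3} where
  r G H := Nonempty (G.1 ≃g H.1)
  iseqv := ⟨fun _ => ⟨SimpleGraph.Iso.refl⟩, fun ⟨e⟩ => ⟨e.symm⟩, fun ⟨e⟩ ⟨f⟩ => ⟨e.trans f⟩⟩

/-- `𝓜ₙ`: triangle-free graphs on `n` vertices up to isomorphism. -/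
def Model (n : ℕ) : Type := Quotient (isoSetoid n)

instance (n : ℕ) : Finite (Model n) :=
  inferInstanceAs (Finite (Quotient (isoSetoid n)))

instance (n : ℕ) : Fintype (Model n) := Fintype.ofFinite _

/-- The isomorphism class of a triangle-free graph. -/
def Model.mk {n : ℕ} (G : SimpleGraph (Fin n)) (h : G.CliqueFree 3) : Model n :=
  Quotient.mk (isoSetoid n) ⟨G, h⟩

/-- A graph that represents the isomorphism class `F`. -/
def Model.graph {n : ℕ} (F : Model n) : SimpleGraph (Fin n) := (Quotient.out F).1

theorem Model.cliqueFree {n : ℕ} (F : Model n) : F.graph.CliqueFree 3 := (Quotient.out F).2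

theorem Model.graph_mk {n : ℕ} (G : SimpleGraph (Fin n)) (h : G.CliqueFree 3) :
    Nonempty ((Model.mk G h).graph ≃g G) :=
  Quotient.exact (s := isoSetoid n) (Quotient.out_eq (s := isoSetoid n) _)

theorem Model.eq_of_iso {n : ℕ} {F F' : Model n} (h : Nonempty (F.graph ≃g F'.graph)) :
    F = F' := by
  have h1 : Quotient.mk (isoSetoid n) (Quotient.out F) =
      Quotient.mk (isoSetoid n) (Quotient.out F') := Quotient.sound (s := isoSetoid n) h
  exact (Quotient.out_eq (s := isoSetoid n) F).symm.trans
    (h1.trans (Quotient.out_eq (s := isoSetoid n) F'))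

/-- The one-element set `𝓜₀` consists of the empty graph. -/
def emptyModel : Model 0 := Model.mk ⊥ (SimpleGraph.cliqueFree_bot (by norm_num))

/-- The pentagon. -/
def pentagon : Model 5 :=
  Model.mk (SimpleGraph.cycleGraph 5) (by
    intro s hs
    rw [SimpleGraph.is3Clique_iff] at hs
    obtain ⟨a, b, c, hab, hac, hbc, -⟩ := hs
    revert a b c
    decide)

/-! ### Double counting -/

section Counting

variable {V : Type*}

theorem IsCopy.card_eq {W : Type*} [Fintype W] {H : SimpleGraph W} {G : SimpleGraph V}
    {S : Finset V} (h : IsCopy H G S) : S.card = Fintype.card W := by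
  obtain ⟨e⟩ := h
  have := Fintype.card_congr e.toEquiv
  simpa using this.symm

/-- Copies inside an induced subgraph. -/
theorem isCopy_map {W U : Type*} {H : SimpleGraph W} {K : SimpleGraph U} {G : SimpleGraph V}
    (e : K ↪g G) (T : Finset U) : IsCopy H G (T.map e.toEmbedding) ↔ IsCopy H K T := by
  have key : Nonempty (K.induce (T : Set U) ≃g
      G.induce ((T.map e.toEmbedding : Finset V) : Set V)) := by
    rw [Finset.coe_map]
    refine ⟨⟨Equiv.Set.image _ _ e.injective, ?_⟩⟩
    intro a b
    exact e.map_adj_iff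
  obtain ⟨k⟩ := key
  exact ⟨fun ⟨f⟩ => ⟨f.trans k.symm⟩, fun ⟨f⟩ => ⟨f.trans k⟩⟩

/-- A copy comes from an embedding whose range is the vertex set of the copy. -/
theorem IsCopy.exists_embedding {U : Type*} [Fintype U] {K : SimpleGraph U} {G : SimpleGraph V}
    {S : Finset V} (h : IsCopy K G S) :
    ∃ e : K ↪g G, ∀ A : Finset V, A ⊆ S ↔ ∃ T : Finset U, T.map e.toEmbedding = A := by
  classical
  obtain ⟨k⟩ := h
  refine ⟨k.toEmbedding.trans (SimpleGraph.Embedding.induce _), fun A => ⟨fun hA => ?_, ?_⟩⟩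
  · refine ⟨Finset.univ.filter fun u => ((k u : (S : Set V)) : V) ∈ A, ?_⟩
    ext v
    simp only [Finset.mem_map, Finset.mem_filter, Finset.mem_univ, true_and]
    constructor
    · rintro ⟨u, hu, rfl⟩
      exact hu
    · intro hv
      refine ⟨k.symm ⟨v, hA hv⟩, ?_, ?_⟩
      · simpa using hv
      · change ((k (k.symm ⟨v, hA hv⟩) : (S : Set V)) : V) = v
        simp
  · rintro ⟨T, rfl⟩ v hv
    obtain ⟨u, -, rfl⟩ := Finset.mem_map.1 hv
    exact (k u).2

/-- Every vertex set of size `m` in a triangle-free graph spans exactly one model. -/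
theorem existsUnique_model {G : SimpleGraph V} (hG : G.CliqueFree 3) {m : ℕ} {S : Finset V}
    (hS : S.card = m) : ∃! F : Model m, IsCopy F.graph G S := by
  have hcard : Fintype.card (S : Set V) = m := by simpa using hS
  let b : Fin m ≃ (S : Set V) := (Fintype.equivFinOfCardEq hcard).symm
  let H : SimpleGraph (Fin m) := (G.induce (S : Set V)).comap b
  have i : H ≃g G.induce (S : Set V) := SimpleGraph.Iso.comap b _
  have hH : H.CliqueFree 3 := by
    have e : H ↪g G := i.toEmbedding.trans (SimpleGraph.Embedding.induce _)
    exact hG.comap ⟨e.toCopy⟩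
  refine ⟨Model.mk H hH, ?_, ?_⟩
  · obtain ⟨k⟩ := Model.graph_mk H hH
    exact ⟨k.trans i⟩
  · rintro F ⟨f⟩
    obtain ⟨k⟩ := Model.graph_mk H hH
    exact Model.eq_of_iso ⟨f.trans (k.trans i).symm⟩

variable [Fintype V]

open Classical in
theorem copyCount_of_isCopy {U W : Type*} [Fintype U] {K : SimpleGraph U} {G : SimpleGraph V}
    {S : Finset V} (h : IsCopy K G S) (H : SimpleGraph W) :
    copyCount H K = (Finset.univ.filter fun A : Finset V => A ⊆ S ∧ IsCopy H G A).card := by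
  obtain ⟨e, he⟩ := h.exists_embedding
  refine Finset.card_bij (fun T _ => T.map e.toEmbedding) ?_ ?_ ?_
  · intro T hT
    simp only [Finset.mem_filter, Finset.mem_univ, true_and] at hT ⊢
    exact ⟨(he _).2 ⟨T, rfl⟩, (isCopy_map e T).2 hT⟩
  · intro T _ T' _ hTT
    exact Finset.map_injective _ hTT
  · intro A hA
    simp only [Finset.mem_filter, Finset.mem_univ, true_and] at hA
    obtain ⟨T, rfl⟩ := (he A).1 hA.1
    exact ⟨T, by simpa using (isCopy_map e T).1 hA.2, rfl⟩

open Classical in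
theorem pairCount_of_isCopy {U W₁ W₂ : Type*} [Fintype U] {K : SimpleGraph U} {G : SimpleGraph V}
    {S : Finset V} (h : IsCopy K G S) (H₁ : SimpleGraph W₁) (H₂ : SimpleGraph W₂) :
    pairCount H₁ H₂ K = (Finset.univ.filter fun P : Finset V × Finset V =>
      (P.1 ⊆ S ∧ P.2 ⊆ S) ∧ Disjoint P.1 P.2 ∧ IsCopy H₁ G P.1 ∧ IsCopy H₂ G P.2).card := by
  obtain ⟨e, he⟩ := h.exists_embedding
  refine Finset.card_bij (fun T _ => (T.1.map e.toEmbedding, T.2.map e.toEmbedding)) ?_ ?_ ?_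
  · rintro ⟨T₁, T₂⟩ hT
    simp only [Finset.mem_filter, Finset.mem_univ, true_and] at hT ⊢
    exact ⟨⟨(he _).2 ⟨T₁, rfl⟩, (he _).2 ⟨T₂, rfl⟩⟩, (Finset.disjoint_map _).2 hT.1,
      (isCopy_map e T₁).2 hT.2.1, (isCopy_map e T₂).2 hT.2.2⟩
  · rintro ⟨T₁, T₂⟩ _ ⟨T₁', T₂'⟩ _ hTT
    simp only [Prod.mk.injEq] at hTT
    exact Prod.ext (Finset.map_injective _ hTT.1) (Finset.map_injective _ hTT.2)
  · rintro ⟨A₁, A₂⟩ hA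
    simp only [Finset.mem_filter, Finset.mem_univ, true_and] at hA
    obtain ⟨T₁, rfl⟩ := (he A₁).1 hA.1.1
    obtain ⟨T₂, rfl⟩ := (he A₂).1 hA.1.2
    refine ⟨(T₁, T₂), ?_, rfl⟩
    simp only [Finset.mem_filter, Finset.mem_univ, true_and]
    exact ⟨(Finset.disjoint_map _).1 hA.2.1, (isCopy_map e T₁).1 hA.2.2.1,
      (isCopy_map e T₂).1 hA.2.2.2⟩

open Classical in
/-- Summation over models, weighted by their copies in `G`, is summation over vertex sets. -/
theorem sum_models {G : SimpleGraph V} (hG : G.CliqueFree 3) (m : ℕ) (c : Model m → ℝ)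
    (d w : Finset V → ℝ) (hcd : ∀ F S, IsCopy F.graph G S → c F = d S) :
    ∑ F : Model m, c F * ∑ S : Finset V, (if IsCopy F.graph G S then w S else 0) =
      ∑ S : Finset V, if S.card = m then d S * w S else 0 := by
  simp_rw [Finset.mul_sum]
  rw [Finset.sum_comm]
  refine Finset.sum_congr rfl fun S _ => ?_
  by_cases hS : S.card = m
  · rw [if_pos hS]
    obtain ⟨F, hF, hu⟩ := existsUnique_model hG hS
    rw [Finset.sum_eq_single F]
    · rw [if_pos hF, hcd F S hF]
    · intro F' _ hne
      rw [if_neg fun h => hne (hu F' h), mul_zero]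
    · simp
  · rw [if_neg hS]
    refine Finset.sum_eq_zero fun F _ => ?_
    rw [if_neg, mul_zero]
    intro h
    exact hS (by simpa using h.card_eq)

open Classical in
/-- The weighted chain rule for a pair of models that exhausts the intermediate model. -/
theorem sum_pairCount_mul {G : SimpleGraph V} (hG : G.CliqueFree 3) {k₁ k₂ : ℕ}
    (F₁ : Model k₁) (F₂ : Model k₂) (w : Finset V → ℝ) :
    ∑ F : Model (k₁ + k₂), (pairCount F₁.graph F₂.graph F.graph : ℝ) *
        ∑ S : Finset V, (if IsCopy F.graph G S then w S else 0) =
      ∑ P : Finset V × Finset V,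
        if Disjoint P.1 P.2 ∧ IsCopy F₁.graph G P.1 ∧ IsCopy F₂.graph G P.2
          then w (P.1 ∪ P.2) else 0 := by
  rw [sum_models hG (k₁ + k₂) _ (fun S => ((Finset.univ.filter fun P : Finset V × Finset V =>
      (P.1 ⊆ S ∧ P.2 ⊆ S) ∧ Disjoint P.1 P.2 ∧ IsCopy F₁.graph G P.1 ∧
        IsCopy F₂.graph G P.2).card : ℝ)) w
    (fun F S h => by rw [pairCount_of_isCopy h])]
  simp_rw [Finset.card_filter, Nat.cast_sum, Finset.sum_mul]
  have : ∀ S : Finset V, (if S.card = k₁ + k₂ then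
      ∑ P : Finset V × Finset V, ((if (P.1 ⊆ S ∧ P.2 ⊆ S) ∧ Disjoint P.1 P.2 ∧
        IsCopy F₁.graph G P.1 ∧ IsCopy F₂.graph G P.2 then 1 else 0 : ℕ) : ℝ) * w S else 0) =
      ∑ P : Finset V × Finset V, if S.card = k₁ + k₂ then
        ((if (P.1 ⊆ S ∧ P.2 ⊆ S) ∧ Disjoint P.1 P.2 ∧
        IsCopy F₁.graph G P.1 ∧ IsCopy F₂.graph G P.2 then 1 else 0 : ℕ) : ℝ) * w S else 0 := by
    intro S
    split_ifs <;> simp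
  rw [Finset.sum_congr rfl fun S _ => this S, Finset.sum_comm]
  refine Finset.sum_congr rfl fun P _ => ?_
  by_cases hP : Disjoint P.1 P.2 ∧ IsCopy F₁.graph G P.1 ∧ IsCopy F₂.graph G P.2
  · have hc : (P.1 ∪ P.2).card = k₁ + k₂ := by
      rw [Finset.card_union_of_disjoint hP.1, hP.2.1.card_eq, hP.2.2.card_eq]
      simp
    rw [if_pos hP, Finset.sum_eq_single (P.1 ∪ P.2)]
    · rw [if_pos hc, if_pos ⟨⟨Finset.subset_union_left, Finset.subset_union_right⟩, hP⟩]
      simp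
    · intro S _ hne
      by_cases hS : S.card = k₁ + k₂
      · have hn : ¬((P.1 ⊆ S ∧ P.2 ⊆ S) ∧ Disjoint P.1 P.2 ∧
            IsCopy F₁.graph G P.1 ∧ IsCopy F₂.graph G P.2) := by
          rintro ⟨⟨h1, h2⟩, -⟩
          exact hne (Finset.eq_of_subset_of_card_le (Finset.union_subset h1 h2)
            (by rw [hc, hS])).symm
        rw [if_pos hS, if_neg hn, Nat.cast_zero, zero_mul]
      · rw [if_neg hS]
    · simp
  · rw [if_neg hP]
    refine Finset.sum_eq_zero fun S _ => ?_
    have hn : ¬((P.1 ⊆ S ∧ P.2 ⊆ S) ∧ Disjoint P.1 P.2 ∧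
        IsCopy F₁.graph G P.1 ∧ IsCopy F₂.graph G P.2) := fun h => hP h.2
    rw [if_neg hn]
    simp

theorem copyCount_eq_sum {W : Type*} (H : SimpleGraph W) (G : SimpleGraph V) :
    (copyCount H G : ℝ) = ∑ S : Finset V, by classical exact if IsCopy H G S then 1 else 0 := by
  classical
  rw [copyCount, Finset.card_filter]
  push_cast
  rfl

open Classical in
theorem pairCount_eq_sum {W₁ W₂ : Type*} (H₁ : SimpleGraph W₁) (H₂ : SimpleGraph W₂)
    (G : SimpleGraph V) : (pairCount H₁ H₂ G : ℝ) = ∑ S : Finset V, if IsCopy H₁ G S then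
      (((Finset.univ.filter fun T : Finset V => Disjoint S T ∧ IsCopy H₂ G T).card : ℕ) : ℝ)
      else 0 := by
  rw [pairCount, Finset.card_filter, Fintype.sum_prod_type]
  push_cast
  refine Finset.sum_congr rfl fun S _ => ?_
  by_cases h : IsCopy H₁ G S
  · rw [if_pos h, Finset.card_filter]
    push_cast
    exact Finset.sum_congr rfl fun T _ => if_congr (by tauto) rfl rfl
  · rw [if_neg h]
    exact Finset.sum_eq_zero fun T _ => if_neg (by tauto)

theorem pairCount_comm {W₁ W₂ : Type*} (H₁ : SimpleGraph W₁) (H₂ : SimpleGraph W₂)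
    (G : SimpleGraph V) : pairCount H₁ H₂ G = pairCount H₂ H₁ G := by
  classical
  refine Finset.card_bij (fun P _ => P.swap) ?_ ?_ ?_
  · intro P hP
    simp only [Finset.mem_filter, Finset.mem_univ, true_and, Prod.fst_swap, Prod.snd_swap] at hP ⊢
    exact ⟨hP.1.symm, hP.2.2, hP.2.1⟩
  · intro P _ Q _ h
    exact Prod.swap_injective h
  · intro P hP
    simp only [Finset.mem_filter, Finset.mem_univ, true_and] at hP
    exact ⟨P.swap, by simpa using ⟨hP.1.symm, hP.2.2, hP.2.1⟩, Prod.swap_swap P⟩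

open Classical in
/-- The number of triples of disjoint copies. -/
def tripleCount {W₁ W₂ W₃ : Type*} (H₁ : SimpleGraph W₁) (H₂ : SimpleGraph W₂)
    (H₃ : SimpleGraph W₃) (G : SimpleGraph V) : ℝ :=
  ∑ S₁ : Finset V, ∑ S₂ : Finset V, ∑ S₃ : Finset V,
    if (Disjoint S₁ S₂ ∧ Disjoint S₁ S₃ ∧ Disjoint S₂ S₃) ∧
      IsCopy H₁ G S₁ ∧ IsCopy H₂ G S₂ ∧ IsCopy H₃ G S₃ then 1 else 0

theorem tripleCount_rotate {W₁ W₂ W₃ : Type*} (H₁ : SimpleGraph W₁) (H₂ : SimpleGraph W₂)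
    (H₃ : SimpleGraph W₃) (G : SimpleGraph V) :
    tripleCount H₂ H₃ H₁ G = tripleCount H₁ H₂ H₃ G := by
  classical
  unfold tripleCount
  conv_rhs => rw [Finset.sum_comm]
  refine Finset.sum_congr rfl fun S₂ _ => ?_
  conv_rhs => rw [Finset.sum_comm]
  refine Finset.sum_congr rfl fun S₃ _ => Finset.sum_congr rfl fun S₁ _ => ?_
  refine if_congr ?_ rfl rfl
  rw [disjoint_comm (a := S₂) (b := S₁), disjoint_comm (a := S₃) (b := S₁)]
  tauto

theorem sum_pair_pair {G : SimpleGraph V} (hG : G.CliqueFree 3) {k₁ k₂ k₃ : ℕ}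
    (F₁ : Model k₁) (F₂ : Model k₂) (F₃ : Model k₃) :
    ∑ F : Model (k₁ + k₂), (pairCount F₁.graph F₂.graph F.graph : ℝ) *
        (pairCount F.graph F₃.graph G : ℝ) = tripleCount F₁.graph F₂.graph F₃.graph G := by
  classical
  simp_rw [pairCount_eq_sum _ F₃.graph G]
  rw [sum_pairCount_mul hG F₁ F₂
    (fun S => (((Finset.univ.filter fun T : Finset V =>
      Disjoint S T ∧ IsCopy F₃.graph G T).card : ℕ) : ℝ)), Fintype.sum_prod_type]
  unfold tripleCount
  refine Finset.sum_congr rfl fun S₁ _ => Finset.sum_congr rfl fun S₂ _ => ?_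
  by_cases h : Disjoint S₁ S₂ ∧ IsCopy F₁.graph G S₁ ∧ IsCopy F₂.graph G S₂
  · rw [if_pos h, Finset.card_filter]
    push_cast
    refine Finset.sum_congr rfl fun S₃ _ => if_congr ?_ rfl rfl
    rw [Finset.disjoint_union_left]
    tauto
  · rw [if_neg h]
    symm
    refine Finset.sum_eq_zero fun S₃ _ => if_neg ?_
    tauto

theorem sum_pair_copy {G : SimpleGraph V} (hG : G.CliqueFree 3) {k₁ k₂ : ℕ}
    (F₁ : Model k₁) (F₂ : Model k₂) :
    ∑ F : Model (k₁ + k₂), (pairCount F₁.graph F₂.graph F.graph : ℝ) *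
        (copyCount F.graph G : ℝ) = pairCount F₁.graph F₂.graph G := by
  classical
  simp_rw [copyCount_eq_sum _ G]
  rw [sum_pairCount_mul hG F₁ F₂ (fun _ => 1), pairCount, Finset.card_filter]
  push_cast
  rfl

theorem sum_copy_pair {G : SimpleGraph V} (hG : G.CliqueFree 3) {k₁ k₂ m : ℕ}
    (hV : Fintype.card V = m + k₂) (F₁ : Model k₁) (F₂ : Model k₂) :
    ∑ F : Model m, (copyCount F₁.graph F.graph : ℝ) *
        (pairCount F.graph F₂.graph G : ℝ) = pairCount F₁.graph F₂.graph G := by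
  classical
  simp_rw [pairCount_eq_sum _ F₂.graph G]
  rw [sum_models hG m _ (fun S => ((Finset.univ.filter fun A : Finset V =>
      A ⊆ S ∧ IsCopy F₁.graph G A).card : ℝ)) _ (fun F S h => by rw [copyCount_of_isCopy h])]
  have e1 : ∀ S : Finset V, (if S.card = m then
      ((Finset.univ.filter fun A : Finset V => A ⊆ S ∧ IsCopy F₁.graph G A).card : ℝ) *
      ((Finset.univ.filter fun T : Finset V => Disjoint S T ∧ IsCopy F₂.graph G T).card : ℝ)
      else 0) = ∑ A : Finset V, ∑ T : Finset V,
        if S = Tᶜ ∧ Disjoint A T ∧ IsCopy F₁.graph G A ∧ IsCopy F₂.graph G T then 1 else 0 := by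
    intro S
    by_cases hS : S.card = m
    · rw [if_pos hS, Finset.card_filter, Finset.card_filter]
      push_cast
      rw [Finset.sum_mul_sum]
      refine Finset.sum_congr rfl fun A _ => Finset.sum_congr rfl fun T _ => ?_
      rw [ite_zero_mul_ite_zero, one_mul]
      refine if_congr ?_ rfl rfl
      constructor
      · rintro ⟨⟨h1, h2⟩, h3, h4⟩
        refine ⟨Finset.eq_of_subset_of_card_le ?_ ?_, Finset.disjoint_of_subset_left h1 h3, h2, h4⟩
        · exact Finset.subset_compl_iff_disjoint_right.2 h3
        · rw [Finset.card_compl, h4.card_eq, hV, hS]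
          simp
      · rintro ⟨rfl, h1, h2, h3⟩
        exact ⟨⟨Finset.subset_compl_iff_disjoint_right.2 h1, h2⟩, disjoint_compl_left, h3⟩
    · rw [if_neg hS]
      symm
      refine Finset.sum_eq_zero fun A _ => Finset.sum_eq_zero fun T _ => if_neg ?_
      rintro ⟨rfl, -, -, h⟩
      apply hS
      rw [Finset.card_compl, h.card_eq, hV]
      simp
  rw [Finset.sum_congr rfl fun S _ => e1 S, Finset.sum_comm]
  refine Finset.sum_congr rfl fun A _ => ?_
  rw [Finset.sum_comm]
  by_cases hA : IsCopy F₁.graph G A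
  · rw [if_pos hA, Finset.card_filter]
    push_cast
    refine Finset.sum_congr rfl fun T _ => ?_
    simp only [hA, true_and]
    rw [Finset.sum_eq_single Tᶜ]
    · simp
    · intro S _ hne
      exact if_neg fun h => hne h.1
    · simp
  · rw [if_neg hA]
    refine Finset.sum_eq_zero fun T _ => Finset.sum_eq_zero fun S _ => if_neg ?_
    tauto

end Counting

/-! ### Chain rules for densities -/

theorem choose_identity (k₁ k₂ r : ℕ) :
    (k₁ + k₂ + r).choose (k₁ + k₂) * (k₁ + k₂).choose k₁ =
      (k₁ + k₂ + r).choose k₁ * (k₂ + r).choose k₂ := by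
  rw [Nat.choose_mul (by omega)]
  congr 2 <;> omega

theorem jointDensity_comm {k₁ k₂ n : ℕ} (F₁ : Model k₁) (F₂ : Model k₂) (G : Model n)
    (hn : n = k₁ + k₂) :
    jointDensity F₁.graph F₂.graph G.graph = jointDensity F₂.graph F₁.graph G.graph := by
  subst hn
  unfold jointDensity
  rw [pairCount_comm]
  simp only [Fintype.card_fin, Nat.add_sub_cancel_left, Nat.add_sub_cancel, Nat.choose_self,
    mul_one]
  rw [Nat.choose_symm_add]

/-- `∑_F p(F₁, F₂; F) p(F, G) = p(F₁, F₂; G)`. -/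
theorem chain_joint {k₁ k₂ n : ℕ} (hn : k₁ + k₂ ≤ n) (F₁ : Model k₁) (F₂ : Model k₂)
    (G : Model n) :
    ∑ F : Model (k₁ + k₂), jointDensity F₁.graph F₂.graph F.graph * density F.graph G.graph =
      jointDensity F₁.graph F₂.graph G.graph := by
  obtain ⟨r, rfl⟩ := Nat.exists_eq_add_of_le hn
  unfold jointDensity density
  simp only [Fintype.card_fin, Nat.add_sub_cancel_left, Nat.choose_self, mul_one]
  simp_rw [div_mul_div_comm]
  rw [← Finset.sum_div, sum_pair_copy G.cliqueFree]
  congr 1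
  have := choose_identity k₁ k₂ r
  rw [show k₁ + k₂ + r - k₁ = k₂ + r by omega, ← this]
  push_cast
  ring

/-- `∑_F p(F₁, F) p(F, F₂; G) = p(F₁, F₂; G)`. -/
theorem chain_left {k₁ k₂ m : ℕ} (hm : k₁ ≤ m) (F₁ : Model k₁) (F₂ : Model k₂)
    (G : Model (m + k₂)) :
    ∑ F : Model m, density F₁.graph F.graph * jointDensity F.graph F₂.graph G.graph =
      jointDensity F₁.graph F₂.graph G.graph := by
  unfold jointDensity density
  simp only [Fintype.card_fin, Nat.add_sub_cancel_left, Nat.choose_self, mul_one]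
  simp_rw [div_mul_div_comm]
  rw [← Finset.sum_div, sum_copy_pair G.cliqueFree (by simp)]
  congr 1
  obtain ⟨r, rfl⟩ := Nat.exists_eq_add_of_le hm
  have h1 := choose_identity k₁ r k₂
  rw [show k₁ + r + k₂ - k₁ = r + k₂ by omega, ← Nat.choose_symm_add (a := r) (b := k₂), ← h1]
  push_cast
  ring

theorem sum_joint_joint {k₁ k₂ k₃ n : ℕ} (hn : n = k₁ + k₂ + k₃) (F₁ : Model k₁) (F₂ : Model k₂)
    (F₃ : Model k₃) (G : Model n) :
    ∑ F : Model (k₁ + k₂), jointDensity F₁.graph F₂.graph F.graph *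
        jointDensity F.graph F₃.graph G.graph =
      tripleCount F₁.graph F₂.graph F₃.graph G.graph /
        ((n.choose k₁ * (k₂ + k₃).choose k₂ : ℕ) : ℝ) := by
  subst hn
  unfold jointDensity
  simp only [Fintype.card_fin, Nat.add_sub_cancel_left, Nat.choose_self, mul_one]
  simp_rw [div_mul_div_comm]
  rw [← Finset.sum_div, sum_pair_pair G.cliqueFree, ← choose_identity]
  push_cast
  rw [mul_comm]

theorem jointDensity_assoc {k₁ k₂ k₃ n : ℕ} (hn : n = k₁ + k₂ + k₃) (F₁ : Model k₁)
    (F₂ : Model k₂) (F₃ : Model k₃) (G : Model n) :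
    ∑ F : Model (k₁ + k₂), jointDensity F₁.graph F₂.graph F.graph *
        jointDensity F.graph F₃.graph G.graph =
      ∑ F : Model (k₂ + k₃), jointDensity F₂.graph F₃.graph F.graph *
        jointDensity F₁.graph F.graph G.graph := by
  have h : ∀ F : Model (k₂ + k₃), jointDensity F₁.graph F.graph G.graph =
      jointDensity F.graph F₁.graph G.graph := fun F => jointDensity_comm F₁ F G (by omega)
  simp_rw [h]
  rw [sum_joint_joint hn, sum_joint_joint (show n = k₂ + k₃ + k₁ by omega), tripleCount_rotate F₁.graph]
  have e : n.choose k₁ * (k₂ + k₃).choose k₂ = n.choose k₂ * (k₃ + k₁).choose k₃ := by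
    have e' : n = k₂ + k₃ + k₁ := by omega
    rw [e', ← choose_identity k₂ k₃ k₁, ← Nat.choose_symm_add (a := k₂ + k₃) (b := k₁),
      Nat.choose_symm_add (a := k₂) (b := k₃)]
  rw [e]

theorem jointDensity_empty {k n : ℕ} (F : Model k) (G : Model n) :
    jointDensity emptyModel.graph F.graph G.graph = density F.graph G.graph := by
  classical
  unfold jointDensity density
  simp only [Fintype.card_fin, Nat.choose_zero_right, one_mul, Nat.sub_zero]
  congr 2
  refine (Finset.card_bij (fun S _ => ((∅ : Finset (Fin n)), S)) ?_ ?_ ?_).symm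
  · intro S hS
    simp only [Finset.mem_filter, Finset.mem_univ, true_and] at hS ⊢
    refine ⟨Finset.disjoint_empty_left _, ⟨⟨⟨fun x => x.elim0, fun x => absurd x.2 (by simp),
      fun x => x.elim0, fun x => absurd x.2 (by simp)⟩, fun {x} => x.elim0⟩⟩, hS⟩
  · intro S _ T _ h
    exact (Prod.mk.inj h).2
  · rintro ⟨A, S⟩ h
    simp only [Finset.mem_filter, Finset.mem_univ, true_and] at h
    have hA : A = ∅ := by
      have := h.2.1.card_eq
      simpa using this
    exact ⟨S, by simpa using h.2.2, by rw [hA]⟩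

/-! ### The flag algebra `𝓐⁰` of the theory of triangle-free graphs -/

/-- `ℝ𝓜`: formal real linear combinations of triangle-free graphs up to isomorphism. -/
abbrev FlagSpace : Type := (Σ n, Model n) →₀ ℝ

/-- The basis vector of `ℝ𝓜` that belongs to the graph `F`. -/
def basisVec {n : ℕ} (F : Model n) : FlagSpace := Finsupp.single ⟨n, F⟩ 1

/-- `𝓚⁰`: the span of the relations `F - ∑_{G ∈ 𝓜_ℓ} p(F, G) G`, where `|F| ≤ ℓ`. -/
def relations : Submodule ℝ FlagSpace :=
  Submodule.span ℝ {x | ∃ (k l : ℕ) (_ : k ≤ l) (F : Model k),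
    x = basisVec F - ∑ G : Model l, density F.graph G.graph • basisVec G}

/-- The flag algebra `𝓐⁰ = ℝ𝓜 / 𝓚⁰`. -/
def FlagAlgebra : Type := FlagSpace ⧸ relations

namespace FlagAlgebra

instance : AddCommGroup FlagAlgebra := inferInstanceAs (AddCommGroup (FlagSpace ⧸ relations))

instance : Module ℝ FlagAlgebra := inferInstanceAs (Module ℝ (FlagSpace ⧸ relations))

/-- The quotient map `ℝ𝓜 → 𝓐⁰`. -/
def proj : FlagSpace →ₗ[ℝ] FlagAlgebra := relations.mkQ

/-- The element of `𝓐⁰` that is represented by the graph `F`. -/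
def of {n : ℕ} (F : Model n) : FlagAlgebra := proj (basisVec F)

theorem of_eq_sum {k l : ℕ} (h : k ≤ l) (F : Model k) :
    of F = ∑ G : Model l, density F.graph G.graph • of G := by
  have h1 : proj (basisVec F - ∑ G : Model l, density F.graph G.graph • basisVec G) = 0 :=
    (Submodule.Quotient.mk_eq_zero relations).2 (Submodule.subset_span ⟨k, l, h, F, rfl⟩)
  rw [map_sub, map_sum, sub_eq_zero] at h1
  simp only [map_smul] at h1
  exact h1

/-- The product of two graphs, `∑_{G ∈ 𝓜_{k₁ + k₂}} p(F₁, F₂; G) G`. -/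
def mulModel (F₁ F₂ : Σ n, Model n) : FlagAlgebra :=
  ∑ G : Model (F₁.1 + F₂.1), jointDensity F₁.2.graph F₂.2.graph G.graph • of G

/-- The bilinear extension of the product to `ℝ𝓜`. -/
def preMul : FlagSpace →ₗ[ℝ] FlagSpace →ₗ[ℝ] FlagAlgebra :=
  Finsupp.lift _ ℝ _ fun F₁ => Finsupp.lift _ ℝ _ fun F₂ => mulModel F₁ F₂

theorem preMul_basisVec {k₁ k₂ : ℕ} (F₁ : Model k₁) (F₂ : Model k₂) :
    preMul (basisVec F₁) (basisVec F₂) = mulModel ⟨k₁, F₁⟩ ⟨k₂, F₂⟩ := by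
  simp [preMul, basisVec]

theorem sum_layer {n n' : ℕ} (h : n = n') (c : ∀ m, Model m → ℝ) :
    ∑ G : Model n, c n G • of G = ∑ G : Model n', c n' G • of G := by
  subst h
  rfl

theorem mulModel_comm (F₁ F₂ : Σ n, Model n) : mulModel F₁ F₂ = mulModel F₂ F₁ := by
  unfold mulModel
  rw [sum_layer (Nat.add_comm F₁.1 F₂.1)
    (fun m G => jointDensity F₁.2.graph F₂.2.graph G.graph)]
  refine Finset.sum_congr rfl fun G _ => ?_
  rw [jointDensity_comm _ _ _ (Nat.add_comm _ _)]

theorem preMul_comm (x y : FlagSpace) : preMul x y = preMul y x := by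
  have : preMul = preMul.flip := by
    refine Finsupp.lhom_ext' fun F₁ => LinearMap.ext_ring (Finsupp.lhom_ext' fun F₂ =>
      LinearMap.ext_ring ?_)
    simpa [preMul] using mulModel_comm F₁ F₂
  rw [this, LinearMap.flip_apply, ← this]

theorem preMul_relations {x : FlagSpace} (hx : x ∈ relations) (y : FlagSpace) :
    preMul x y = 0 := by
  suffices h : relations ≤ LinearMap.ker preMul by
    have := h hx
    rw [LinearMap.mem_ker] at this
    rw [this, LinearMap.zero_apply]
  rw [relations, Submodule.span_le]
  rintro _ ⟨k, l, hkl, F, rfl⟩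
  rw [SetLike.mem_coe, LinearMap.mem_ker]
  refine Finsupp.lhom_ext' fun ⟨k₂, F₂⟩ => LinearMap.ext_ring ?_
  change preMul _ (basisVec F₂) = 0
  rw [map_sub, map_sum, LinearMap.sub_apply, LinearMap.sum_apply, sub_eq_zero]
  simp_rw [map_smul, LinearMap.smul_apply, preMul_basisVec, mulModel]
  change ∑ G : Model (k + k₂), jointDensity F.graph F₂.graph G.graph • of G =
    ∑ F' : Model l, density F.graph F'.graph •
      ∑ G : Model (l + k₂), jointDensity F'.graph F₂.graph G.graph • of G
  simp_rw [Finset.smul_sum, smul_smul]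
  conv_rhs => rw [Finset.sum_comm]
  simp_rw [← Finset.sum_smul, chain_left hkl]
  have : ∀ G : Model (k + k₂), of G =
      ∑ G' : Model (l + k₂), density G.graph G'.graph • of G' :=
    fun G => of_eq_sum (by omega) G
  rw [Finset.sum_congr rfl fun G _ => by rw [this G]]
  simp_rw [Finset.smul_sum, smul_smul]
  rw [Finset.sum_comm]
  simp_rw [← Finset.sum_smul, chain_joint (show k + k₂ ≤ l + k₂ by omega)]

/-- The product of `𝓐⁰` as a bilinear map. -/
def mulMap : FlagAlgebra →ₗ[ℝ] FlagAlgebra →ₗ[ℝ] FlagAlgebra :=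
  relations.liftQ
    (LinearMap.flip (relations.liftQ preMul.flip fun x hx => by
      rw [LinearMap.mem_ker]
      refine LinearMap.ext fun y => ?_
      rw [LinearMap.flip_apply, preMul_comm, preMul_relations hx, LinearMap.zero_apply]))
    fun x hx => by
      rw [LinearMap.mem_ker]
      refine LinearMap.ext fun z => ?_
      obtain ⟨y, rfl⟩ := Submodule.mkQ_surjective relations z
      exact preMul_relations hx y

instance : Mul FlagAlgebra := ⟨fun x y => mulMap x y⟩

instance : One FlagAlgebra := ⟨of emptyModel⟩

theorem of_mul_of {k₁ k₂ : ℕ} (F₁ : Model k₁) (F₂ : Model k₂) :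
    of F₁ * of F₂ = ∑ G : Model (k₁ + k₂), jointDensity F₁.graph F₂.graph G.graph • of G :=
  preMul_basisVec F₁ F₂

theorem add_mul' (x y z : FlagAlgebra) : (x + y) * z = x * z + y * z := by
  change mulMap (x + y) z = mulMap x z + mulMap y z
  rw [map_add, LinearMap.add_apply]

theorem mul_add' (x y z : FlagAlgebra) : x * (y + z) = x * y + x * z := by
  change mulMap x (y + z) = mulMap x y + mulMap x z
  rw [map_add]

theorem smul_mul' (r : ℝ) (x y : FlagAlgebra) : (r • x) * y = r • (x * y) := by
  change mulMap (r • x) y = r • mulMap x y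
  rw [map_smul, LinearMap.smul_apply]

theorem mul_smul' (r : ℝ) (x y : FlagAlgebra) : x * (r • y) = r • (x * y) := by
  change mulMap x (r • y) = r • mulMap x y
  rw [map_smul]

theorem zero_mul' (x : FlagAlgebra) : 0 * x = 0 := by
  change mulMap 0 x = 0
  rw [map_zero, LinearMap.zero_apply]

theorem mul_zero' (x : FlagAlgebra) : x * 0 = 0 := by
  change mulMap x 0 = 0
  rw [map_zero]

/-- Graphs span the flag algebra. -/
theorem induction {p : FlagAlgebra → Prop} (h0 : p 0) (ha : ∀ x y, p x → p y → p (x + y))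
    (hs : ∀ (r : ℝ) x, p x → p (r • x)) (ho : ∀ (n : ℕ) (F : Model n), p (of F))
    (x : FlagAlgebra) : p x := by
  obtain ⟨y, rfl⟩ : ∃ y, proj y = x := Submodule.mkQ_surjective relations x
  induction y using Finsupp.induction_linear with
  | zero => rw [map_zero]; exact h0
  | add f g hf hg => rw [map_add]; exact ha _ _ hf hg
  | single F r =>
    have : Finsupp.single F r = r • basisVec F.2 := by simp [basisVec]
    rw [this, map_smul]
    exact hs r _ (ho F.1 F.2)

theorem mul_comm' (x y : FlagAlgebra) : x * y = y * x := by
  obtain ⟨a, rfl⟩ : ∃ a, proj a = x := Submodule.mkQ_surjective relations x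
  obtain ⟨b, rfl⟩ : ∃ b, proj b = y := Submodule.mkQ_surjective relations y
  exact preMul_comm a b

theorem one_mul' (x : FlagAlgebra) : 1 * x = x := by
  induction x using induction with
  | h0 => exact mul_zero' _
  | ha x y hx hy => rw [mul_add', hx, hy]
  | hs r x hx => rw [mul_smul', hx]
  | ho n F =>
    change of emptyModel * of F = of F
    rw [of_mul_of]
    simp_rw [jointDensity_empty]
    exact (of_eq_sum (by omega) F).symm

theorem sum_mul' {ι : Type*} (s : Finset ι) (f : ι → FlagAlgebra) (y : FlagAlgebra) :
    (∑ i ∈ s, f i) * y = ∑ i ∈ s, f i * y := by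
  change mulMap (∑ i ∈ s, f i) y = ∑ i ∈ s, mulMap (f i) y
  rw [map_sum, LinearMap.sum_apply]

theorem mul_sum' {ι : Type*} (s : Finset ι) (f : ι → FlagAlgebra) (y : FlagAlgebra) :
    y * (∑ i ∈ s, f i) = ∑ i ∈ s, y * f i := by
  change mulMap y (∑ i ∈ s, f i) = ∑ i ∈ s, mulMap y (f i)
  rw [map_sum]

theorem of_mul_assoc {k₁ k₂ k₃ : ℕ} (F₁ : Model k₁) (F₂ : Model k₂) (F₃ : Model k₃) :
    of F₁ * of F₂ * of F₃ = of F₁ * (of F₂ * of F₃) := by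
  rw [of_mul_of, of_mul_of, sum_mul', mul_sum']
  simp_rw [smul_mul', mul_smul', of_mul_of, Finset.smul_sum, smul_smul]
  rw [Finset.sum_comm]
  conv_rhs => rw [Finset.sum_comm]
  simp_rw [← Finset.sum_smul]
  rw [sum_layer (Nat.add_assoc k₁ k₂ k₃) (fun m G => ∑ F : Model (k₁ + k₂),
    jointDensity F₁.graph F₂.graph F.graph * jointDensity F.graph F₃.graph G.graph)]
  refine Finset.sum_congr rfl fun G _ => ?_
  rw [jointDensity_assoc (by omega)]

theorem mul_assoc' (x y z : FlagAlgebra) : x * y * z = x * (y * z) := by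
  induction x using induction with
  | h0 => simp only [zero_mul']
  | ha x x' hx hx' => simp only [add_mul', hx, hx']
  | hs r x hx => simp only [smul_mul', hx]
  | ho k₁ F₁ =>
  induction y using induction with
  | h0 => simp only [zero_mul', mul_zero']
  | ha x x' hx hx' => simp only [add_mul', mul_add', hx, hx']
  | hs r x hx => simp only [smul_mul', mul_smul', hx]
  | ho k₂ F₂ =>
  induction z using induction with
  | h0 => simp only [mul_zero']
  | ha x x' hx hx' => simp only [mul_add', hx, hx']
  | hs r x hx => simp only [mul_smul', hx]
  | ho k₃ F₃ => exact of_mul_assoc F₁ F₂ F₃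

instance : CommRing FlagAlgebra :=
  { (inferInstance : AddCommGroup FlagAlgebra) with
    mul := (· * ·)
    one := 1
    left_distrib := mul_add'
    right_distrib := add_mul'
    zero_mul := zero_mul'
    mul_zero := mul_zero'
    mul_assoc := mul_assoc'
    one_mul := one_mul'
    mul_one := fun x => by rw [mul_comm', one_mul']
    mul_comm := mul_comm' }

instance : Algebra ℝ FlagAlgebra := Algebra.ofModule smul_mul' mul_smul'

/-- `Hom⁺(𝓐⁰, ℝ)`: the unital algebra homomorphisms that are nonnegative on all graphs. -/
def PosHom : Set (FlagAlgebra →ₐ[ℝ] ℝ) :=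
  {φ | ∀ (n : ℕ) (F : Model n), 0 ≤ φ (of F)}

/-- The inequality `f ≤ g` in the flag algebra: `φ(f) ≤ φ(g)` for every `φ ∈ Hom⁺(𝓐⁰, ℝ)`. -/
def AsympLE (f g : FlagAlgebra) : Prop :=
  ∀ φ ∈ PosHom, φ f ≤ φ g

end FlagAlgebra

end

end TFFlag

namespace TFFlag

/-! ### A sum-of-squares certificate for the pentagon density

A map `t : Fin 5 → V` is read as a type `(t 0, t 1, t 2)` together with two independent
vertices `t 3`, `t 4`. The neighbourhood of a vertex in the type is described by three Booleans.
-/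

/-! The extremal example is the balanced blow-up of the pentagon, which has `2 n⁵ / 625` closed
walks of length five. The upper bound is a sum-of-squares argument. A 5-tuple of vertices,
repetitions allowed, pulls the graph back to a loopless triangle-free graph on `Fin 5`. On each such
graph, the closed-walk count over vertex orders, suitably weighted, plus a symmetrised square form
is at most a constant; `certificate_adjOfBits_le` checks these finitely many cases. Summed over all
`n⁵` tuples, the form becomes a nonnegative combination of genuine squares (`sum_squareForm_nonneg`)
and can be dropped, which yields `sum_closedWalkForm_le`. The coefficients are such that, in the
balanced blow-up, every sum being squared is zero, as sharpness requires. Because repetitions are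
allowed, no error term appears.

A pentagon carries ten closed walks (`ten_mul_copyCount_le`), so there are at most `(n / 5)⁵`
pentagons. Division by `n.choose 5`, which is asymptotic to `n⁵ / 5!`, gives the limiting density.
In the flag algebra, a positive homomorphism restricts to a probability distribution on the graphs
of each fixed size (`asympLE_of_density_le`); its value at the pentagon is an average of finite
densities, and letting the size grow gives the theorem. -/

/-- The function on three Booleans with the given values, the first argument changing fastest. -/
def boolTable (v₀ v₁ v₂ v₃ v₄ v₅ v₆ v₇ : ℤ) (x y z : Bool) : ℤ :=
  bif z then (bif y then (bif x then v₇ else v₆) else (bif x then v₅ else v₄))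
  else (bif y then (bif x then v₃ else v₂) else (bif x then v₁ else v₀))

/-- The weighted squares that are used for the type with adjacencies `ab`, `ac`, `bc`: none unless
the type is empty, the edge `ab`, or the path with centre `c`. -/
def typeSquares : Bool → Bool → Bool → List (ℕ × (Bool → Bool → Bool → ℤ))
  | false, false, false =>
    [(16, boolTable 30 (-43) (-43) 28 (-43) 28 28 (-45)),
     (64736, boolTable 0 1 1 (-1) 1 (-1) (-1) 0),
     (25200, boolTable 0 1 (-1) 0 0 1 (-1) 0),
     (25200, boolTable 0 0 1 1 (-1) (-1) 0 0),
     (25200, boolTable 0 1 0 1 (-1) 0 (-1) 0)]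
  | true, false, false =>
    [(24, boolTable (-64) 17 17 0 150 15 15 0),
     (99, boolTable (-38) 49 49 0 0 (-30) (-30) 0),
     (3045, boolTable 2 (-1) (-1) 0 0 0 0 0),
     (480, boolTable 0 15 (-15) 0 0 (-1) 1 0),
     (1227120, boolTable 0 0 0 0 0 1 (-1) 0)]
  | false, true, true =>
    [(115200, boolTable 2 1 1 0 (-1) 0 0 0),
     (27900, boolTable 4 1 1 (-2) 0 0 0 0),
     (1173600, boolTable 0 1 (-1) 0 0 0 0 0)]
  | _, _, _ => []

/-- The bilinear form of the weighted squares, evaluated at the 5-vertex graph `A`. -/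
def squareForm (A : Fin 5 → Fin 5 → Bool) : ℤ :=
  ((typeSquares (A 0 1) (A 0 2) (A 1 2)).map fun s =>
    (s.1 : ℤ) * (s.2 (A 0 3) (A 1 3) (A 2 3) * s.2 (A 0 4) (A 1 4) (A 2 4))).sum

/-- The indicator of `0, 1, 2, 3, 4` being a closed walk in `A`. -/
def closedWalkForm (A : Fin 5 → Fin 5 → Bool) : ℤ :=
  bif A 0 1 && (A 1 2 && (A 2 3 && (A 3 4 && A 4 0))) then 1 else 0

/-- The 5-tuple with the given entries. -/
def tuple {α : Type*} (a b c d e : α) (i : Fin 5) : α :=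
  match i.val with
  | 0 => a
  | 1 => b
  | 2 => c
  | 3 => d
  | _ => e

/-- Representatives of the permutations of `Fin 5` modulo the swaps of `0, 1` and of `3, 4`. -/
def typeOrders : List (Fin 5 → Fin 5) :=
  [tuple 1 2 0 3 4, tuple 1 3 0 2 4, tuple 1 4 0 2 3, tuple 2 3 0 1 4, tuple 2 4 0 1 3,
   tuple 3 4 0 1 2, tuple 0 2 1 3 4, tuple 0 3 1 2 4, tuple 0 4 1 2 3, tuple 2 3 1 0 4,
   tuple 2 4 1 0 3, tuple 3 4 1 0 2, tuple 0 1 2 3 4, tuple 0 3 2 1 4, tuple 0 4 2 1 3,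
   tuple 1 3 2 0 4, tuple 1 4 2 0 3, tuple 3 4 2 0 1, tuple 0 1 3 2 4, tuple 0 2 3 1 4,
   tuple 0 4 3 1 2, tuple 1 2 3 0 4, tuple 1 4 3 0 2, tuple 2 4 3 0 1, tuple 0 1 4 2 3,
   tuple 0 2 4 1 3, tuple 0 3 4 1 2, tuple 1 2 4 0 3, tuple 1 3 4 0 2, tuple 2 3 4 0 1]

/-- Representatives of the permutations of `Fin 5` modulo the symmetries of the pentagon. -/
def cycleOrders : List (Fin 5 → Fin 5) :=
  [tuple 0 1 2 3 4, tuple 0 1 2 4 3, tuple 0 1 3 2 4, tuple 0 1 3 4 2, tuple 0 1 4 2 3,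
   tuple 0 1 4 3 2, tuple 0 2 1 3 4, tuple 0 2 1 4 3, tuple 0 2 3 1 4, tuple 0 2 4 1 3,
   tuple 0 3 1 2 4, tuple 0 3 2 1 4]

/-- The certificate, symmetrised over the orders of the vertices. -/
def certificate (A : Fin 5 → Fin 5 → Bool) : ℤ :=
  11250000 * (cycleOrders.map fun π => closedWalkForm fun i j => A (π i) (π j)).sum +
    (typeOrders.map fun π => squareForm fun i j => A (π i) (π j)).sum

/-! ### The finite verification on five labelled vertices -/

/-- The adjacency function of the 5-vertex graph with the given edges. -/
def adjOfBits (a b c d e f g h i j : Bool) : Fin 5 → Fin 5 → Bool :=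
  tuple (tuple false a b c d) (tuple a false e f g) (tuple b e false h i) (tuple c f h false j)
    (tuple d g i j false)

/-- No triangle in the graph with the given edges. -/
def noTriangleBits (a b c d e f g h i j : Bool) : Bool :=
  !(a && b && e || a && c && f || a && d && g || b && c && h || b && d && i || c && d && j ||
    e && f && h || e && g && i || f && g && j || h && i && j)

/-- Ten bits encode all 1024 labelled graphs, and integer coefficients make the check a pure
computation. -/
theorem certificate_adjOfBits_le : ∀ a b c d e f g h i j : Bool,
    noTriangleBits a b c d e f g h i j = true →
      certificate (adjOfBits a b c d e f g h i j) ≤ 432000 := by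
  decide +kernel

/-- The hypotheses survive pulling back along any map into a triangle-free graph, injective or not:
vertices with the same image are simply nonadjacent. -/
theorem certificate_le {A : Fin 5 → Fin 5 → Bool} (hirr : ∀ i, A i i = false)
    (hsymm : ∀ i j, A i j = A j i) (htri : ∀ i j k, ¬(A i j ∧ A i k ∧ A j k)) :
    certificate A ≤ 432000 := by
  have hA : A = adjOfBits (A 0 1) (A 0 2) (A 0 3) (A 0 4) (A 1 2) (A 1 3) (A 1 4) (A 2 3)
      (A 2 4) (A 3 4) := by
    funext i j
    fin_cases i <;> fin_cases j <;> first | exact hirr _ | rfl | exact hsymm _ _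
  rw [hA]
  refine certificate_adjOfBits_le _ _ _ _ _ _ _ _ _ _ ?_
  have h : ∀ i j k, (A i j && A i k && A j k) = false := fun i j k => by
    simpa [and_assoc] using htri i j k
  simp only [noTriangleBits, h, Bool.or_false, Bool.not_false]

/-! ### Summation over maps into a graph -/

section Sums

variable {V : Type*} [Fintype V]

/-- Separates the type `a, b, c` from the two free vertices `x, y`, so that the type can be held
fixed. -/
theorem sum_fin_five (f : V → V → V → V → V → ℤ) :
    ∑ t : Fin 5 → V, f (t 0) (t 1) (t 2) (t 3) (t 4) =
      ∑ a, ∑ b, ∑ c, ∑ x, ∑ y, f a b c x y := by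
  let e : V × V × V × V × V ≃ (Fin 5 → V) :=
    { toFun p := ![p.1, p.2.1, p.2.2.1, p.2.2.2.1, p.2.2.2.2]
      invFun t := (t 0, t 1, t 2, t 3, t 4)
      left_inv _ := rfl
      right_inv t := by
        funext i
        fin_cases i <;> rfl }
  rw [← e.sum_comp]
  simp_rw [Fintype.sum_prod_type]
  rfl

theorem sum_comp_bijective {π : Fin 5 → Fin 5} (hπ : π.Bijective) (f : (Fin 5 → V) → ℤ) :
    ∑ t : Fin 5 → V, f (fun i => t (π i)) = ∑ t, f t :=
  ((Equiv.ofBijective π hπ).symm.arrowCongr (Equiv.refl V)).sum_comp f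

theorem sum_list_sum {ι κ : Type*} [Fintype ι] (L : List κ) (f : κ → ι → ℤ) :
    ∑ i, (L.map fun k => f k i).sum = (L.map fun k => ∑ i, f k i).sum := by
  induction L with
  | nil => simp
  | cons k L ih => simp [Finset.sum_add_distrib, ih]

/-- Precomposition with a bijection only permutes the tuples, so each order contributes the same
total. Hence only bijectivity and the number of listed orders matter after summation. -/
theorem sum_orders {L : List (Fin 5 → Fin 5)} (hL : ∀ π ∈ L, π.Bijective)
    (f : (Fin 5 → V) → ℤ) :
    ∑ t : Fin 5 → V, (L.map fun π => f fun i => t (π i)).sum = L.length * ∑ t, f t := by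
  rw [sum_list_sum, List.map_congr_left fun π hπ => sum_comp_bijective (hL π hπ) f]
  simp

/-- The form never looks at the adjacency of vertices `3` and `4`. For a fixed type, the double sum
over them therefore factors into the square of a single sum. -/
theorem sum_squareForm_nonneg (A : V → V → Bool) :
    0 ≤ ∑ t : Fin 5 → V, squareForm fun i j => A (t i) (t j) := by
  unfold squareForm
  rw [sum_fin_five fun a b c x y => ((typeSquares (A a b) (A a c) (A b c)).map fun s =>
    (s.1 : ℤ) * (s.2 (A a x) (A b x) (A c x) * s.2 (A a y) (A b y) (A c y))).sum]
  refine Finset.sum_nonneg fun a _ => Finset.sum_nonneg fun b _ => Finset.sum_nonneg fun c _ => ?_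
  simp_rw [sum_list_sum]
  refine List.sum_nonneg fun z hz => ?_
  obtain ⟨s, -, rfl⟩ := List.mem_map.1 hz
  simp_rw [← Finset.mul_sum]
  rw [← Finset.sum_mul]
  exact mul_nonneg (Nat.cast_nonneg _) (mul_self_nonneg _)

theorem typeOrders_bijective : ∀ π ∈ typeOrders, Function.Bijective π := by
  have h : typeOrders.all (fun π => decide π.Injective) = true := by
    decide +kernel
  exact fun π hπ => Finite.injective_iff_bijective.1 (of_decide_eq_true (List.all_eq_true.1 h π hπ))

theorem cycleOrders_bijective : ∀ π ∈ cycleOrders, Function.Bijective π := by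
  have h : cycleOrders.all (fun π => decide π.Injective) = true := by
    decide +kernel
  exact fun π hπ => Finite.injective_iff_bijective.1 (of_decide_eq_true (List.all_eq_true.1 h π hπ))

/-- A triangle-free graph on `n` vertices has at most `2 n⁵ / 625` closed walks of length five. -/
theorem sum_closedWalkForm_le {A : V → V → Bool} (hirr : ∀ i, A i i = false)
    (hsymm : ∀ i j, A i j = A j i) (htri : ∀ i j k, ¬(A i j ∧ A i k ∧ A j k)) :
    625 * ∑ t : Fin 5 → V, closedWalkForm (fun i j => A (t i) (t j)) ≤
      2 * (Fintype.card V : ℤ) ^ 5 := by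
  -- The sum runs over all tuples, not only injective ones; this keeps the bound exact for every
  -- `n`.
  have h : ∑ t : Fin 5 → V, certificate (fun i j => A (t i) (t j)) ≤
      ∑ _t : Fin 5 → V, 432000 :=
    Finset.sum_le_sum fun t _ => certificate_le (fun _ => hirr _) (fun _ _ => hsymm _ _)
      fun _ _ _ => htri _ _ _
  unfold certificate at h
  rw [Finset.sum_add_distrib, ← Finset.mul_sum,
    sum_orders cycleOrders_bijective fun t => closedWalkForm fun i j => A (t i) (t j),
    sum_orders typeOrders_bijective fun t => squareForm fun i j => A (t i) (t j)] at h
  have h' := sum_squareForm_nonneg A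
  have e1 : cycleOrders.length = 12 := rfl
  have e2 : typeOrders.length = 30 := rfl
  simp only [e1, e2, Finset.sum_const, Finset.card_univ, Fintype.card_fun, Fintype.card_fin,
    nsmul_eq_mul] at h
  push_cast at h
  -- The closed walks have coefficient `12 * 11250000 = 135000000`, and `432000 / 135000000 = 2 /
  -- 625`.
  linarith

end Sums

/-! ### Pentagons in finite triangle-free graphs -/

theorem IsCopy.congr_left {W W' V : Type*} {H : SimpleGraph W} {H' : SimpleGraph W'}
    (e : H ≃g H') (G : SimpleGraph V) (S : Finset V) : IsCopy H G S ↔ IsCopy H' G S :=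
  ⟨fun ⟨f⟩ => ⟨e.symm.trans f⟩, fun ⟨f⟩ => ⟨e.trans f⟩⟩

theorem density_congr_left {W W' V : Type*} [Fintype W] [Fintype W'] [Fintype V]
    {H : SimpleGraph W} {H' : SimpleGraph W'} (e : H ≃g H') (G : SimpleGraph V) :
    density H G = density H' G := by
  classical
  unfold density copyCount
  rw [Fintype.card_congr e.toEquiv, Finset.filter_congr fun S _ => IsCopy.congr_left e G S]

/-- The empty graph is the unit of the algebra, so this expands `1` as the sum of all models of any
one size. -/
theorem density_emptyModel {n : ℕ} (G : Model n) : density emptyModel.graph G.graph = 1 := by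
  classical
  have h : (Finset.univ.filter fun S : Finset (Fin n) => IsCopy emptyModel.graph G.graph S) =
      {∅} := by
    ext S
    simp only [Finset.mem_filter, Finset.mem_univ, true_and, Finset.mem_singleton]
    constructor
    · intro h
      simpa using h.card_eq
    · rintro rfl
      exact ⟨⟨⟨fun x => x.elim0, fun x => absurd x.2 (by simp), fun x => x.elim0,
        fun x => absurd x.2 (by simp)⟩, fun {x} => x.elim0⟩⟩
  have h1 : copyCount emptyModel.graph G.graph = 1 := by
    unfold copyCount
    convert Finset.card_singleton (∅ : Finset (Fin n)) using 2
  simp [density, h1]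

/-- The symmetries of the pentagon: rotations and reflections. -/
def dihedralMap (q : Fin 5 × Bool) (i : Fin 5) : Fin 5 :=
  bif q.2 then q.1 + i else q.1 - i

/-- The ten symmetries are distinct as maps, so one pentagon yields ten different walks. -/
theorem dihedralMap_injective : Function.Injective dihedralMap := by
  decide +kernel

/-- Each walk visits all of its pentagon, so the walk determines the vertex set. -/
theorem dihedralMap_surjective : ∀ q, Function.Surjective (dihedralMap q) := by
  decide +kernel

theorem cycleGraph_adj_dihedralMap : ∀ q i,
    (SimpleGraph.cycleGraph 5).Adj (dihedralMap q i) (dihedralMap q (i + 1)) := by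
  decide +kernel

section Pentagons

variable {V : Type*} [Fintype V]

open Classical in
/-- Every pentagon in `G` gives ten closed walks. -/
theorem ten_mul_copyCount_le (G : SimpleGraph V) :
    10 * copyCount (SimpleGraph.cycleGraph 5) G ≤
      (Finset.univ.filter fun t : Fin 5 → V => ∀ i, G.Adj (t i) (t (i + 1))).card := by
  -- One parametrisation is fixed per vertex set; the ten walks are its composites with the
  -- symmetries.
  let e : ∀ S : {S : Finset V // IsCopy (SimpleGraph.cycleGraph 5) G S},
    SimpleGraph.cycleGraph 5 ≃g G.induce (S.1 : Set V) := fun S => S.2.some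
  let walk : {S : Finset V // IsCopy (SimpleGraph.cycleGraph 5) G S} × (Fin 5 × Bool) →
      {t : Fin 5 → V // ∀ i, G.Adj (t i) (t (i + 1))} := fun p =>
    ⟨fun i => (e p.1 (dihedralMap p.2 i) : V), fun i =>
      (e p.1).map_adj_iff.2 (cycleGraph_adj_dihedralMap p.2 i)⟩
  have hwalk : Function.Injective walk := by
    -- The vertex set is recovered as the range of the walk. Equal walks thus share `S` and its
    -- chosen parametrisation, which leaves only the symmetry to compare.
    have hrange : ∀ p v, v ∈ p.1.1 ↔ ∃ i, (walk p).1 i = v := by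
      refine fun p v => ⟨fun hv => ?_, ?_⟩
      · obtain ⟨j, hj⟩ := (e p.1).surjective ⟨v, hv⟩
        obtain ⟨i, rfl⟩ := dihedralMap_surjective p.2 j
        exact ⟨i, congrArg Subtype.val hj⟩
      · rintro ⟨i, rfl⟩
        exact (e p.1 (dihedralMap p.2 i)).2
    rintro ⟨S, q⟩ ⟨S', q'⟩ h
    obtain rfl : S = S' := by
      refine Subtype.ext (Finset.ext fun v => ?_)
      rw [hrange (S, q) v, hrange (S', q') v, h]
    congr 1
    refine dihedralMap_injective (funext fun i => (e S).injective (Subtype.ext ?_))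
    exact congrFun (congrArg Subtype.val h) i
  have := Fintype.card_le_of_injective walk hwalk
  rw [Fintype.card_prod, Fintype.card_subtype, Fintype.card_subtype] at this
  simpa [copyCount, mul_comm] using this

/-- A triangle-free graph on `n` vertices has at most `(n / 5)⁵` pentagons. -/
theorem copyCount_pentagon_le {G : SimpleGraph V} (hG : G.CliqueFree 3) :
    5 ^ 5 * copyCount (SimpleGraph.cycleGraph 5) G ≤ Fintype.card V ^ 5 := by
  classical
  have h := sum_closedWalkForm_le (A := fun u v => decide (G.Adj u v)) (by simp)
    (fun u v => by simp [G.adj_comm]) (fun u v w => by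
      simp only [decide_eq_true_eq]
      exact fun h => hG {u, v, w} (SimpleGraph.is3Clique_triple_iff.2 h))
  -- Addition in `Fin 5` wraps around, so `i = 4` is the closing edge of the walk.
  have hsum : ∑ t : Fin 5 → V, closedWalkForm (fun i j => decide (G.Adj (t i) (t j))) =
      ((Finset.univ.filter fun t : Fin 5 → V => ∀ i, G.Adj (t i) (t (i + 1))).card : ℤ) := by
    rw [Finset.card_filter, Nat.cast_sum]
    refine Finset.sum_congr rfl fun t _ => ?_
    simp [closedWalkForm, Fin.forall_fin_succ, Bool.cond_eq_ite]
  rw [hsum] at h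
  have h10 := ten_mul_copyCount_le G
  zify at h10 ⊢
  -- Ten walks per pentagon: `6250 * copies ≤ 2 * n ^ 5`, which is then halved.
  linarith

theorem density_pentagon_le {G : SimpleGraph V} (hG : G.CliqueFree 3) :
    density (SimpleGraph.cycleGraph 5) G ≤
      (Fintype.card V : ℝ) ^ 5 / 5 ^ 5 / ((Fintype.card V).choose 5 : ℝ) := by
  unfold density
  rw [Fintype.card_fin]
  -- With fewer than five vertices the binomial coefficient is zero, and both quotients are zero by
  -- convention.
  gcongr
  rw [le_div_iff₀' (by positivity)]
  exact_mod_cast copyCount_pentagon_le hG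

end Pentagons

/-! ### Asymptotic normalisation -/

open Filter Topology in
-- Inverts the equivalence of `n.choose k` with `n ^ k / k!`, turning the exact count into a
-- limiting density.
theorem tendsto_pow_div_choose (k : ℕ) :
    Tendsto (fun n : ℕ => (n : ℝ) ^ k / (n.choose k : ℝ)) atTop (𝓝 (k.factorial : ℝ)) := by
  have hk : (k.factorial : ℝ) ≠ 0 := mod_cast k.factorial_ne_zero
  have h := (Asymptotics.isEquivalent_iff_tendsto_one (by
    filter_upwards [eventually_ge_atTop k] with n hn
    exact mod_cast (Nat.choose_pos hn).ne')).1 (isEquivalent_choose k).symm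
  refine (h.const_mul (k.factorial : ℝ)).congr (fun n => ?_) |>.trans (by rw [mul_one])
  simp only [Pi.div_apply]
  field_simp

/-- Large triangle-free graphs have pentagon density at most `5! / 5⁵ + ε`. -/
theorem exists_forall_density_pentagon_le {ε : ℝ} (hε : 0 < ε) :
    ∃ N : ℕ, ∀ (V : Type*) [Fintype V] (G : SimpleGraph V), N ≤ Fintype.card V →
      G.CliqueFree 3 →
        density (SimpleGraph.cycleGraph 5) G ≤ (Nat.factorial 5 : ℝ) / 5 ^ 5 + ε := by
  have h := (tendsto_pow_div_choose 5).div_const ((5 : ℝ) ^ 5)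
  obtain ⟨N, hN⟩ := Filter.eventually_atTop.1
    (h.eventually_le_const (lt_add_of_pos_right _ hε))
  refine ⟨N, fun V _ G hV hG => (density_pentagon_le hG).trans ?_⟩
  rw [div_right_comm]
  exact hN _ hV

/-! ### Transfer to the flag algebra -/

namespace FlagAlgebra

/-- A bound for the densities of `F` in all models of some size bounds `F` in the flag algebra. -/
theorem asympLE_of_density_le {k l : ℕ} (hkl : k ≤ l) (F : Model k) {c : ℝ}
    (h : ∀ G : Model l, density F.graph G.graph ≤ c) :
    AsympLE (of F) (algebraMap ℝ FlagAlgebra c) := by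
  intro φ hφ
  -- Expanding the unit over the models of size `l` shows that the nonnegative numbers `φ (of G)`
  -- form a probability distribution, so `φ (of F)` is a weighted average of densities.
  have h1 : ∑ G : Model l, φ (of G) = 1 := by
    have := congrArg φ (of_eq_sum (Nat.zero_le l) emptyModel)
    simp only [density_emptyModel, one_smul, map_sum] at this
    rw [← this]
    exact map_one φ
  rw [AlgHom.commutes, of_eq_sum hkl F, map_sum]
  calc ∑ G : Model l, φ (density F.graph G.graph • of G)
      = ∑ G : Model l, density F.graph G.graph * φ (of G) := by simp
    _ ≤ ∑ G : Model l, c * φ (of G) :=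
        Finset.sum_le_sum fun G _ => mul_le_mul_of_nonneg_right (h G) (hφ l G)
    _ = c := by rw [← Finset.mul_sum, h1, mul_one]

end FlagAlgebra

end TFFlag

theorem theorem3p1 :
    TFFlag.FlagAlgebra.AsympLE (TFFlag.FlagAlgebra.of TFFlag.pentagon)
      (algebraMap ℝ TFFlag.FlagAlgebra ((Nat.factorial 5 : ℝ) / 5 ^ 5)) ∧
    ∀ ε : ℝ, 0 < ε → ∃ N : ℕ, ∀ (V : Type*) [Fintype V] (G : SimpleGraph V),
      N ≤ Fintype.card V → G.CliqueFree 3 →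
        TFFlag.density (SimpleGraph.cycleGraph 5) G ≤ (Nat.factorial 5 : ℝ) / 5 ^ 5 + ε := by
  refine ⟨fun φ hφ => ?_, fun ε hε => TFFlag.exists_forall_density_pentagon_le hε⟩
  rw [AlgHom.commutes]
  -- Finite graphs can exceed the limiting density, so each size gives a bound only up to `ε`.
  refine le_of_forall_pos_le_add fun ε hε => ?_
  obtain ⟨N, hN⟩ := TFFlag.exists_forall_density_pentagon_le hε
  -- The representative of the isomorphism class is chosen from a quotient, hence is only isomorphic
  -- to `cycleGraph 5`.
  obtain ⟨e⟩ : Nonempty (TFFlag.pentagon.graph ≃g SimpleGraph.cycleGraph 5) :=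
    TFFlag.Model.graph_mk _ _
  -- Size `N + 5` is at least `N`, for the density bound, and at least `5`, for expanding the
  -- pentagon.
  have h := TFFlag.FlagAlgebra.asympLE_of_density_le (Nat.le_add_left 5 N) TFFlag.pentagon
    (fun G => (TFFlag.density_congr_left e G.graph).le.trans
      (hN (Fin (N + 5)) G.graph (by simp) G.cliqueFree)) φ hφ
  rwa [AlgHom.commutes] at h
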